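/- Let $A$ be a finite set. A clone on $A$ is a set of finitary operations on $A$ of positive arity that contains all projections and is closed under composition. For an integer $k>1$, a $k$-edge operation is a function $t\colon A^{k+1}\to A$ such that for all $x,y\in A$ $$t(y,y,x,\dots,x)=t(y,x,y,x,\dots,x)=x$$ and, for every $i\in\{4,\dots,k+1\}$, $t(x,\dots,x,y,x,\dots,x)=x$ with $y$ in position $i$. For a set $S$ of finitary relations on $A$ (subsets of $A^n$, $n\ge 1$), let $\mathrm{Pol}(A,S)$ be the clone of all operations on $A$ of positive arity that preserve every relation in $S$. Fix $k>1$ and let $\mathcal M_k$ be the set of all clones on $A$ that contain a $k$-edge operation. Then: 1. For every clone $C\in\mathcal M_k$ there is a finitary relation $R$ on $A$ such that $C=\mathrm{Pol}(A,\{R\})$. 2. There is no infinite (strictly) descending chain in $(\mathcal M_k,\subseteq)$. 3. The set $\mathcal M_k$ is finite or countably infinite. In particular, every clone on $A$ that contains a Malcev operation (a function $m\colon A^3\to A$ with $m(x,y,y)=m(y,y,x)=x$ for all $x,y\in A$) is finitely related, that is, equal to $\mathrm{Pol}(A,S)$ for some finite set $S$ of finitary relations on $A$; and the set of all such clones on $A$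 is finite or countably infinite. -/

import Mathlib

/-- A finitary relation on `A`: a subset of `A ^ arity` for some positive integer `arity`. -/
structure FinitaryRelation (A : Type*) where
  arity : ℕ
  arity_pos : 0 < arity
  tuples : Set (Fin arity → A)

/-- The `n`-ary operation `f` on `A` preserves the relation `R`: applying `f` coordinatewise to
any `n` tuples of `R` gives a tuple of `R`. -/
def Preserves {A : Type*} {n : ℕ} (f : (Fin n → A) → A) (R : FinitaryRelation A) : Prop :=
  ∀ r : Fin n → Fin R.arity → A, (∀ j, r j ∈ R.tuples) →
    (fun i => f (fun j => r j i)) ∈ R.tuples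

/-- A clone on `A`: a set of operations on `A` of positive arity that contains all projections
and is closed under composition. The set `ops n` consists of its `n`-ary members. -/
@[ext]
structure Clone (A : Type*) where
  ops : ∀ n : ℕ, Set ((Fin n → A) → A)
  arity_pos : ∀ {n : ℕ} {f : (Fin n → A) → A}, f ∈ ops n → 0 < n
  proj_mem : ∀ (n : ℕ) (i : Fin n), (fun x : Fin n → A => x i) ∈ ops n
  comp_mem : ∀ {m n : ℕ} {f : (Fin m → A) → A} {g : Fin m → (Fin n → A) → A},
    f ∈ ops m → (∀ i, g i ∈ ops n) → (fun x => f (fun i => g i x)) ∈ ops n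

namespace Clone

/-- Clones on `A` are ordered by inclusion. -/
instance {A : Type*} : PartialOrder (Clone A) :=
  PartialOrder.lift Clone.ops (fun _ _ h => Clone.ext h)

theorem le_iff {A : Type*} (C D : Clone A) : C ≤ D ↔ ∀ n, C.ops n ⊆ D.ops n := Iff.rfl

/-- `Pol (A, S)`: the clone of all operations on `A` (of positive arity) that preserve every
relation in `S`. -/
def Pol {A : Type*} (S : Set (FinitaryRelation A)) : Clone A where
  ops n := {f | 0 < n ∧ ∀ R ∈ S, Preserves f R}
  arity_pos h := h.1
  proj_mem n i := ⟨i.pos, fun _ _ _ hr => hr i⟩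
  comp_mem {m n f g} hf hg :=
    ⟨(hg ⟨0, hf.1⟩).1, fun R hR r hr =>
      hf.2 R hR (fun i c => g i (fun j => r j c)) (fun i => (hg i).2 R hR r hr)⟩

/-- A clone is finitely related if it consists of exactly those operations that preserve every
member of some finite set of finitary relations (these relations are then subalgebras of powers
of the algebra whose operations are those of the clone). -/
def FinitelyRelated {A : Type*} (C : Clone A) : Prop :=
  ∃ S : Set (FinitaryRelation A), S.Finite ∧ C = Pol S

end Clone

/-- `k`-edge operations (meant for `2 ≤ k`): operations `t` of arity `k + 1` with
`t(y,y,x,…,x) = t(y,x,y,x,…,x) = x`, and `t(x,…,x,y,x,…,x) = x` whenever `y` stands in one of the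
positions `4, …, k + 1`. Positions are counted from `0` in the code. -/
def IsEdgeOperation {A : Type*} (k : ℕ) (t : (Fin (k + 1) → A) → A) : Prop :=
  (∀ x y : A, t (fun i => if i.val = 0 ∨ i.val = 1 then y else x) = x) ∧
  (∀ x y : A, t (fun i => if i.val = 0 ∨ i.val = 2 then y else x) = x) ∧
  (∀ i : Fin (k + 1), 3 ≤ i.val → ∀ x y : A, t (fun j => if j = i then y else x) = x)

/-- Malcev operations: `m(x,y,y) = m(y,y,x) = x` for all `x`, `y`. -/
def IsMalcevOperation {A : Type*} (m : (Fin 3 → A) → A) : Prop :=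
  ∀ x y : A, m ![x, y, y] = x ∧ m ![y, y, x] = x

/-- The set of all clones on `A` that contain a `k`-edge operation. -/
def edgeClones (A : Type*) (k : ℕ) : Set (Clone A) :=
  {C | ∃ t ∈ C.ops (k + 1), IsEdgeOperation k t}

/-- The set of all Malcev clones on `A`, that is, clones that contain a Malcev operation. -/
def malcevClones (A : Type*) : Set (Clone A) :=
  {C | ∃ m ∈ C.ops 3, IsMalcevOperation m}

/-!
Comparable clones `C ≤ D` sharing a `k`-edge operation coincide as soon as they have the same
operations of arity `|A| ^ (k - 1)` and the same forks. A *fork* of `C` at a word `a` is a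
pair `(f a, g a)`, where `f` and `g` are members of `C` that agree on all words lexicographically
before `a`. Indeed, going through `A ^ n` in lexicographic order, a member of `D` is interpolated
by members of `C` on longer and longer initial segments: equality of the operations of arity
`|A| ^ (k - 1)` gives interpolation on sets of `k - 1` points (`Clone.exists_interpolation`), and
the edge operation combines such interpolants with forks at the next point
(`exists_agree_at_and_on`). This gives `Clone.le_of_forks_subset`.

If a word `b` arises from a word `a` by inserting letters that have already occurred, then every
fork of `C` at `b` is a fork of `C` at `a` (`WordEmbeds.forks_subset`). By Higman's lemma this
embedding relation is a well-quasi-order (`exists_lt_wordEmbeds`). In a strictly descending chain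
of clones with an edge operation, the operations of arity `|A| ^ (k - 1)` are eventually constant,
so from some point on every step loses a fork; two of these lost forks are the same pair at words
that embed into each other in the right order, a contradiction.

The clones of polymorphisms of the `n`-ary part of `C` form a descending chain with intersection
`C`. As the chain is eventually constant, `C` is determined by one relation
(`Clone.exists_eq_pol_singleton`). There are only countably many finitary relations on a finite
set, hence only countably many such clones.
-/

/-! ### Interpolation along a linear order -/

/-- An edge operation with its first three arguments separated from the other `m`; the arity of
the corresponding `k`-edge operation is `m + 3`, so `k = m + 2`. -/
structure IsSplitEdge {A : Type*} {m : ℕ} (T : A → A → A → (Fin m → A) → A) : Prop where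
  left : ∀ x y, T y y x (fun _ => x) = x
  outer : ∀ x y, T y x y (fun _ => x) = x
  rest : ∀ j x y, T x x x (Function.update (fun _ => x) j y) = x

theorem IsEdgeOperation.isSplitEdge {A : Type*} {m : ℕ} {t : (Fin (m + 2 + 1) → A) → A}
    (ht : IsEdgeOperation (m + 2) t) :
    IsSplitEdge fun a b c (e : Fin m → A) => t (Fin.cons a (Fin.cons b (Fin.cons c e))) where
  left x y := by
    refine Eq.trans (congrArg t ?_) (ht.1 x y)
    funext i
    refine Fin.cases rfl (fun i => Fin.cases rfl (fun i => Fin.cases rfl (fun i => ?_) i) i) i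
    simp
  outer x y := by
    refine Eq.trans (congrArg t ?_) (ht.2.1 x y)
    funext i
    refine Fin.cases rfl (fun i => Fin.cases rfl (fun i => Fin.cases rfl (fun i => ?_) i) i) i
    simp
  rest j x y := by
    refine Eq.trans (congrArg t ?_) (ht.2.2 j.succ.succ.succ (by simp) x y)
    funext i
    refine Fin.cases ?_ (fun i => Fin.cases ?_ (fun i => Fin.cases ?_ (fun i => ?_) i) i) i
    · simp [Fin.ext_iff]
    · simp [Fin.ext_iff]
    · exact (if_neg fun h =>
        Fin.succ_ne_zero j (Fin.succ_injective _ (Fin.succ_injective _ h)).symm).symm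
    · simp [Function.update_apply]

/-- Suppose `g ∈ C` agrees with `f` before `a`, and the pair `(f a, g a)` is realised at `a` by two
members `h₁`, `h₂` of `C` that agree before `a`. Then `f` can be interpolated by `C` on `a` together
with any finite set of points before `a`, by induction on that set. -/
theorem exists_agree_at_and_on {A X : Type*} [LinearOrder X] {m : ℕ}
    {T : A → A → A → (Fin m → A) → A} (hT : IsSplitEdge T) {C : Set (X → A)}
    (hC : ∀ f₀ ∈ C, ∀ f₁ ∈ C, ∀ f₂ ∈ C, ∀ fs : Fin m → X → A, (∀ l, fs l ∈ C) →
      (fun x => T (f₀ x) (f₁ x) (f₂ x) (fun l => fs l x)) ∈ C)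
    {f : X → A} (small : ∀ S : Finset X, S.card ≤ m + 1 → ∃ g ∈ C, ∀ x ∈ S, g x = f x)
    {a : X} {g h₁ h₂ : X → A} (hg : g ∈ C) (hgf : ∀ x < a, g x = f x)
    (hh₁ : h₁ ∈ C) (hh₂ : h₂ ∈ C) (hh : ∀ x < a, h₁ x = h₂ x) (h₁a : h₁ a = f a)
    (h₂a : h₂ a = g a) (I : Finset X) (hI : ∀ x ∈ I, x < a) :
    ∃ g' ∈ C, g' a = f a ∧ ∀ x ∈ I, g' x = f x := by
  classical
  induction I using Finset.strongInduction with
  | H I ih =>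
  rcases le_or_gt I.card m with hcard | hcard
  · obtain ⟨g', hg', h⟩ := small (insert a I) ((Finset.card_insert_le _ _).trans (by omega))
    exact ⟨g', hg', h a (Finset.mem_insert_self _ _),
      fun x hx => h x (Finset.mem_insert_of_mem hx)⟩
  obtain ⟨e⟩ : Nonempty (Fin m ↪ I) :=
    Function.Embedding.nonempty_of_card_le (by simpa using hcard.le)
  have hgs : ∀ l, ∃ g' ∈ C, g' a = f a ∧ ∀ x ∈ I.erase (e l), g' x = f x := fun l =>
    ih _ (Finset.erase_ssubset (e l).2) fun x hx => hI x (Finset.mem_of_mem_erase hx)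
  choose gs gsC gsa gsI using hgs
  obtain ⟨q, hq, hqf⟩ := small (insert a (Finset.univ.image fun l => (e l : X)))
    ((Finset.card_insert_le _ _).trans
      (Nat.succ_le_succ (Finset.card_image_le.trans (by simp))))
  have hqa : q a = f a := hqf a (Finset.mem_insert_self _ _)
  have hqe : ∀ l, q (e l) = f (e l) := fun l =>
    hqf _ (Finset.mem_insert_of_mem (Finset.mem_image_of_mem _ (Finset.mem_univ l)))
  -- With `u = g a` and `v = f a`, both `g₁` and `q₁` below take the value `T v v u (v, …, v)` at
  -- `a`. On `I` the function `g₁` still agrees with `f`, while `q₁` agrees with `q`; so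
  -- `T q₁ g₁ q gs` takes the value `v` at `a` and agrees with `f` on `I`.
  let g₁ : X → A := fun x => T (q x) (q x) (g x) (fun l => gs l x)
  let q₁ : X → A := fun x => T (h₁ x) (q x) (h₂ x) (fun _ => q x)
  have hg₁ : g₁ ∈ C := hC q hq q hq g hg gs gsC
  have hq₁ : q₁ ∈ C := hC h₁ hh₁ q hq h₂ hh₂ (fun _ => q) fun _ => hq
  refine ⟨_, hC q₁ hq₁ g₁ hg₁ q hq gs gsC, ?_, fun x hx => ?_⟩
  · have h : q₁ a = g₁ a := by simp only [q₁, g₁, h₁a, h₂a, hqa, gsa]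
    simp only [h, hqa, gsa, hT.left]
  · have hxa := hI x hx
    have hq₁x : q₁ x = q x := by simp only [q₁, hh x hxa, hT.outer]
    by_cases hxe : ∃ l, (e l : X) = x
    · obtain ⟨l, rfl⟩ := hxe
      have hgsx : (fun l' => gs l' (e l)) =
          Function.update (fun _ => f (e l)) l (gs l (e l)) := by
        funext l'
        by_cases hl : l' = l
        · subst hl; simp
        · rw [Function.update_of_ne hl]
          refine gsI l' _ (Finset.mem_erase.2 ⟨fun h => hl ?_, hx⟩)
          exact (e.injective (Subtype.ext h)).symm
      have hg₁x : g₁ (e l) = f (e l) := by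
        simp only [g₁, hqe, hgf _ hxa, hgsx, hT.rest]
      simp only [hq₁x, hg₁x, hqe, hgsx, hT.rest]
    · have hgsx : ∀ l, gs l x = f x := fun l =>
        gsI l x (Finset.mem_erase.2 ⟨fun h => hxe ⟨l, h.symm⟩, hx⟩)
      have hg₁x : g₁ x = f x := by simp only [g₁, hgf x hxa, hgsx, hT.left]
      simp only [hq₁x, hg₁x, hgsx, hT.outer]

/-- A set `C` of functions on a finite linear order that is closed under an edge operation contains
every larger set `D` that has the same forks and can be interpolated by `C` on small sets. -/
theorem subset_of_forks_of_interpolation {A X : Type*} [LinearOrder X] [Finite X] {m : ℕ}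
    {T : A → A → A → (Fin m → A) → A} (hT : IsSplitEdge T) {C D : Set (X → A)} (hCD : C ⊆ D)
    (hC : ∀ f₀ ∈ C, ∀ f₁ ∈ C, ∀ f₂ ∈ C, ∀ fs : Fin m → X → A, (∀ l, fs l ∈ C) →
      (fun x => T (f₀ x) (f₁ x) (f₂ x) (fun l => fs l x)) ∈ C)
    (small : ∀ f ∈ D, ∀ S : Finset X, S.card ≤ m + 1 → ∃ g ∈ C, ∀ x ∈ S, g x = f x)
    (forks : ∀ a, ∀ f ∈ D, ∀ g ∈ D, (∀ x < a, f x = g x) →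
      ∃ f' ∈ C, ∃ g' ∈ C, (∀ x < a, f' x = g' x) ∧ f' a = f a ∧ g' a = g a) : D ⊆ C := by
  classical
  intro f hf
  have : Fintype X := Fintype.ofFinite X
  have key : ∀ s : Finset X, IsLowerSet (s : Set X) → ∃ g ∈ C, ∀ x ∈ s, g x = f x := by
    intro s
    induction s using Finset.induction_on_max with
    | empty => exact fun _ => (small f hf ∅ (by simp)).imp fun g hg => ⟨hg.1, by simp⟩
    | insert a s hs ih =>
      intro hlow
      have hmem : ∀ x < a, x ∈ s := fun x hx =>
        (Finset.mem_insert.1 (hlow hx.le (Finset.mem_insert_self a s))).resolve_left hx.ne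
      obtain ⟨g, hg, hgf⟩ := ih fun x y hyx hx => hmem y (hyx.trans_lt (hs x hx))
      have hgf' : ∀ x < a, g x = f x := fun x hx => hgf x (hmem x hx)
      obtain ⟨h₁, hh₁, h₂, hh₂, hh, h₁a, h₂a⟩ :=
        forks a f hf g (hCD hg) fun x hx => (hgf' x hx).symm
      obtain ⟨g', hg', hga, hgs⟩ := exists_agree_at_and_on hT hC (small f hf) hg hgf' hh₁ hh₂ hh
        h₁a h₂a s hs
      exact ⟨g', hg', fun x hx => (Finset.mem_insert.1 hx).elim (fun h => h ▸ hga) (hgs x)⟩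
  obtain ⟨g, hg, h⟩ := key Finset.univ fun _ _ _ _ => Finset.mem_coe.2 (Finset.mem_univ _)
  rwa [funext fun x => (h x (Finset.mem_univ x)).symm]

/-! ### Forks of a clone -/

namespace Clone

/-- Substituting variables for variables stays inside a clone. -/
theorem comp_vars_mem {A : Type*} (C : Clone A) {m n : ℕ} {f : (Fin m → A) → A}
    (hf : f ∈ C.ops m) (σ : Fin m → Fin n) : (fun x => f (fun i => x (σ i))) ∈ C.ops n :=
  C.comp_mem hf fun i => C.proj_mem n (σ i)

/-- The forks of `C` at the word `a`: the pairs of values at `a` of two members of `C` that agree on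
all words lexicographically before `a`. -/
def forks {A : Type*} [LinearOrder A] (C : Clone A) {n : ℕ} (a : Fin n → A) : Set (A × A) :=
  {p | ∃ f ∈ C.ops n, ∃ g ∈ C.ops n, (∀ c, toLex c < toLex a → f c = g c) ∧
    f a = p.1 ∧ g a = p.2}

theorem forks_mono {A : Type*} [LinearOrder A] {C D : Clone A} (h : C ≤ D) {n : ℕ}
    (a : Fin n → A) : C.forks a ⊆ D.forks a := fun _ ⟨f, hf, g, hg, hfg⟩ =>
  ⟨f, h n hf, g, h n hg, hfg⟩

/-- On `r` points, an `n`-ary operation only depends on the distinct columns of the `r × n` matrix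
of these points, so interpolation at `r` points only involves operations of arity `|A| ^ r`. -/
theorem exists_interpolation {A : Type*} [Finite A] {r : ℕ} {C D : Clone A}
    (h : D.ops (Nat.card (Fin r → A)) ⊆ C.ops (Nat.card (Fin r → A))) {n : ℕ}
    {f : (Fin n → A) → A} (hf : f ∈ D.ops n) (p : Fin r → Fin n → A) :
    ∃ g ∈ C.ops n, ∀ l, g (p l) = f (p l) := by
  have : Nonempty (Fin n) := ⟨⟨0, D.arity_pos hf⟩⟩
  let col : Fin n → Fin r → A := fun i l => p l i
  let e : (Fin r → A) ≃ Fin (Nat.card (Fin r → A)) := Finite.equivFin _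
  let σ : (Fin r → A) → Fin n := Function.invFun col
  have hσ : ∀ i, col (σ (col i)) = col i := fun i => Function.invFun_eq ⟨i, rfl⟩
  refine ⟨_, C.comp_vars_mem (h (D.comp_vars_mem hf fun i => e (col i))) fun w => σ (e.symm w),
    fun l => congrArg f (funext fun i => ?_)⟩
  simpa using congrFun (hσ i) l

theorem exists_interpolation_finset {A : Type*} [Finite A] {r : ℕ} {C D : Clone A}
    (h : D.ops (Nat.card (Fin (r + 1) → A)) ⊆ C.ops (Nat.card (Fin (r + 1) → A))) {n : ℕ}
    {f : (Fin n → A) → A} (hf : f ∈ D.ops n) (S : Finset (Fin n → A)) (hS : S.card ≤ r + 1) :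
    ∃ g ∈ C.ops n, ∀ x ∈ S, g x = f x := by
  rcases S.eq_empty_or_nonempty with rfl | ⟨x₀, hx₀⟩
  · exact ⟨_, C.proj_mem n ⟨0, D.arity_pos hf⟩, by simp⟩
  obtain ⟨e⟩ : Nonempty (S ↪ Fin (r + 1)) :=
    Function.Embedding.nonempty_of_card_le (by simpa using hS)
  have : Nonempty S := ⟨⟨x₀, hx₀⟩⟩
  obtain ⟨g, hg, hgf⟩ := exists_interpolation h hf fun l => (Function.invFun (⇑e) l).1
  refine ⟨g, hg, fun x hx => ?_⟩
  simpa [Function.leftInverse_invFun e.injective ⟨x, hx⟩] using hgf (e ⟨x, hx⟩)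

/-- Comparable clones with a common edge operation are equal once they have the same operations of
one suitable arity and the same forks. -/
theorem le_of_forks_subset {A : Type*} [Finite A] [LinearOrder A] {m : ℕ} {C D : Clone A}
    (hCD : C ≤ D) (hC : C ∈ edgeClones A (m + 2))
    (h : D.ops (Nat.card (Fin (m + 1) → A)) ⊆ C.ops (Nat.card (Fin (m + 1) → A)))
    (hforks : ∀ n, 0 < n → ∀ a : Fin n → A, D.forks a ⊆ C.forks a) : D ≤ C := by
  obtain ⟨t, htC, ht⟩ := hC
  rw [le_iff]
  intro n f hf
  have : Finite (Lex (Fin n → A)) := inferInstanceAs (Finite (Fin n → A))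
  refine subset_of_forks_of_interpolation (X := Lex (Fin n → A)) ht.isSplitEdge (hCD n) ?_
    (fun f hf S hS => exists_interpolation_finset h hf S hS) ?_ hf
  · intro f₀ h₀ f₁ h₁ f₂ h₂ fs hfs
    have := C.comp_mem (n := n) (g := Fin.cons f₀ (Fin.cons f₁ (Fin.cons f₂ fs))) htC
      (Fin.cases h₀ (Fin.cases h₁ (Fin.cases h₂ hfs)))
    refine (congrArg (· ∈ C.ops n) (funext fun x => congrArg t (funext ?_))).mpr this
    exact Fin.cases rfl (Fin.cases rfl (Fin.cases rfl fun _ => rfl))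
  · intro a f hf g hg hfg
    exact hforks n (D.arity_pos hf) a (show (f a, g a) ∈ _ from ⟨f, hf, g, hg, hfg, rfl, rfl⟩)

end Clone

/-! ### Embeddings of words -/

/-- `WordEmbeds a b`: the word `b` arises from `a` by inserting letters, each of which occurs in `b`
at an earlier position. This is expressed by requiring that all letters of `b` occur in `a`, and
that some order embedding of the positions of `a` into those of `b` preserves letters and maps first
occurrences of letters to first occurrences. -/
def WordEmbeds {A : Type*} {m n : ℕ} (a : Fin m → A) (b : Fin n → A) : Prop :=
  Set.range b ⊆ Set.range a ∧ ∃ h : Fin m ↪o Fin n, ∀ i, b (h i) = a i ∧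
    ((∃ j < h i, b j = b (h i)) → ∃ j < i, a j = a i)

/-- If `a` embeds into `b`, then identifying variables turns a fork at `b` into a fork at `a`. -/
theorem WordEmbeds.forks_subset {A : Type*} [LinearOrder A] {m n : ℕ} {a : Fin m → A}
    {b : Fin n → A} (hab : WordEmbeds a b) (C : Clone A) : C.forks b ⊆ C.forks a := by
  obtain ⟨hrange, h, hh⟩ := hab
  have hψ : ∀ j, ∃ i, a i = b j ∧ h i ≤ j ∧ ∀ i', h i' = j → i = i' := by
    intro j
    by_cases hj : ∃ i, h i = j
    · obtain ⟨i, rfl⟩ := hj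
      exact ⟨i, (hh i).1.symm, le_rfl, fun i' hi' => (h.injective hi').symm⟩
    -- An inserted letter is sent to the first occurrence of that letter in `a`.
    · have hex : ∃ i, a i = b j := hrange ⟨j, rfl⟩
      obtain ⟨i, hi, hmin⟩ := WellFounded.has_min (wellFounded_lt (α := Fin m))
        {i | a i = b j} hex
      refine ⟨i, hi, not_lt.1 fun hlt => ?_, fun i' hi' => (hj ⟨i', hi'⟩).elim⟩
      obtain ⟨j', hj', hj'a⟩ := (hh i).2 ⟨j, hlt, hi.symm.trans (hh i).1.symm⟩
      exact hmin j' (hj'a.trans hi) hj'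
  choose ψ hψa hψle hψh using hψ
  have hb : (fun j => a (ψ j)) = b := funext hψa
  rintro p ⟨f, hf, g, hg, hfg, hfp, hgp⟩
  refine ⟨_, C.comp_vars_mem hf ψ, _, C.comp_vars_mem hg ψ, fun c hc => hfg _ ?_, ?_, ?_⟩
  · obtain ⟨i, hlt, hi⟩ := hc
    have hψi : ψ (h i) = i := hψh _ _ rfl
    refine ⟨h i, fun j hj => ?_, ?_⟩
    · exact (hlt (ψ j) (h.lt_iff_lt.1 ((hψle j).trans_lt hj))).trans (hψa j)
    · change c (ψ (h i)) < b (h i)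
      rw [hψi, (hh i).1]
      exact hi
  · simpa only [hb] using hfp
  · simpa only [hb] using hgp

/-- Embedding of nonempty words over a finite alphabet is a well-quasi-order, also in the presence
of a colouring with finitely many colours. -/
theorem exists_lt_wordEmbeds {A P : Type*} [Finite A] [Finite P] (n : ℕ → ℕ) (hn : ∀ s, 0 < n s)
    (w : ∀ s, Fin (n s) → A) (c : ℕ → P) :
    ∃ s s', s < s' ∧ c s = c s' ∧ WordEmbeds (w s) (w s') := by
  -- Each letter also records whether it is repeated, the set of all letters, and the colour; then
  -- Higman's lemma for equality of such decorated letters suffices.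
  let code : ∀ s, Fin (n s) → A × Prop × Set A × P := fun s i =>
    (w s i, ∃ j < i, w s j = w s i, Set.range (w s), c s)
  obtain ⟨s, s', hss, hsub⟩ :=
    (Set.PartiallyWellOrderedOn.partiallyWellOrderedOn_sublistForall₂ (α := A × Prop × Set A × P)
      (· = ·) (s := Set.univ) Set.finite_univ.partiallyWellOrderedOn).exists_lt
      (f := fun s => List.ofFn (code s)) (fun _ _ _ => Set.mem_univ _)
  obtain ⟨l, hl, hls⟩ := List.sublistForall₂_iff.1 hsub
  rw [List.forall₂_eq_eq_eq] at hl
  subst hl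
  obtain ⟨h, hh⟩ := List.sublist_iff_exists_fin_orderEmbedding_get_eq.1 hls
  let h' : Fin (n s) ↪o Fin (n s') :=
    ((Fin.castOrderIso List.length_ofFn.symm).toOrderEmbedding.trans h).trans
      (Fin.castOrderIso List.length_ofFn).toOrderEmbedding
  have hcode : ∀ i, code s i = code s' (h' i) := by
    intro i
    have := hh (Fin.cast List.length_ofFn.symm i)
    rw [List.get_ofFn, List.get_ofFn] at this
    exact this
  have h0 := hcode ⟨0, hn s⟩
  simp only [code, Prod.mk.injEq] at h0 hcode
  exact ⟨s, s', hss, h0.2.2.2, h0.2.2.1.symm.subset, h', fun i =>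
    ⟨(hcode i).1.symm, fun hi => (hcode i).2.1.mpr hi⟩⟩

/-! ### Descending chains and finite relatedness -/

/-- An antitone sequence in a well-founded order is eventually constant. -/
theorem Antitone.exists_forall_eq {α : Type*} [PartialOrder α] [WellFoundedLT α] {c : ℕ → α}
    (hc : Antitone c) : ∃ n, ∀ m, n ≤ m → c m = c n := by
  obtain ⟨_, ⟨n, rfl⟩, hn⟩ :=
    WellFounded.has_min (wellFounded_lt (α := α)) (Set.range c) ⟨_, 0, rfl⟩
  exact ⟨n, fun m hm => (hc hm).eq_of_not_lt (hn _ ⟨m, rfl⟩)⟩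

namespace Clone

theorem not_exists_strictAnti_edgeClones {A : Type*} [Finite A] (m : ℕ) :
    ¬ ∃ c : ℕ → Clone A, (∀ n, c n ∈ edgeClones A (m + 2)) ∧ ∀ n, c (n + 1) < c n := by
  rintro ⟨c, hc, hlt⟩
  let : LinearOrder A := LinearOrder.lift' _ (Finite.equivFin A).injective
  have hanti : Antitone c := antitone_nat_of_succ_le fun n => (hlt n).le
  obtain ⟨n₀, hn₀⟩ := Antitone.exists_forall_eq
    (c := fun n => (c n).ops (Nat.card (Fin (m + 1) → A))) fun _ _ h => hanti h _
  have hfork : ∀ s, ∃ n, ∃ _ : 0 < n, ∃ a : Fin n → A, ∃ p : A × A,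
      p ∈ (c (n₀ + s)).forks a ∧ p ∉ (c (n₀ + s + 1)).forks a := by
    intro s
    by_contra! hcon
    refine (hlt (n₀ + s)).not_ge (le_of_forks_subset (hlt _).le (hc _) ?_ hcon)
    exact ((hn₀ _ (by omega)).trans (hn₀ _ (by omega)).symm).subset
  choose n hn a p hp hp' using hfork
  obtain ⟨s, s', hss, hpp, hemb⟩ := exists_lt_wordEmbeds n hn a p
  refine hp' s ?_
  rw [hpp]
  exact forks_mono (hanti (by omega)) _ (hemb.forks_subset _ (hp s'))

/-- The `n`-ary part of a clone on a nonempty finite set, as a relation of arity `|A| ^ n`. -/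
noncomputable def toRelation {A : Type*} [Finite A] [Nonempty A] (C : Clone A) (n : ℕ) :
    FinitaryRelation A where
  arity := Nat.card (Fin n → A)
  arity_pos := Nat.card_pos
  tuples := {r | (fun x => r (Finite.equivFin (Fin n → A) x)) ∈ C.ops n}

theorem mem_pol_toRelation {A : Type*} [Finite A] [Nonempty A] (C : Clone A) {n m : ℕ}
    {f : (Fin m → A) → A} : f ∈ (Pol {C.toRelation n}).ops m ↔
      0 < m ∧ ∀ g : Fin m → (Fin n → A) → A, (∀ j, g j ∈ C.ops n) →
        (fun x => f fun j => g j x) ∈ C.ops n := by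
  refine and_congr_right fun _ => ⟨fun h g hg => ?_, fun h R hR => ?_⟩
  · let e := Finite.equivFin (Fin n → A)
    have h' : (fun x => f fun j => g j (e.symm (e x))) ∈ C.ops n :=
      h _ rfl (fun j y => g j (e.symm y)) fun j =>
        show (fun x => g j (e.symm (e x))) ∈ C.ops n by simpa using hg j
    simpa using h'
  · obtain rfl : R = C.toRelation n := hR
    exact fun r hr => h (fun j x => r j (Finite.equivFin (Fin n → A) x)) hr

theorem le_pol_toRelation {A : Type*} [Finite A] [Nonempty A] (C : Clone A) (n : ℕ) :
    C ≤ Pol {C.toRelation n} := fun _ _ hf =>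
  C.mem_pol_toRelation.2 ⟨C.arity_pos hf, fun _ hg => C.comp_mem hf hg⟩

/-- Polymorphisms of the `n`-ary part of `C` of arity `n` lie in `C`: apply them to the
projections. -/
theorem pol_toRelation_ops_subset {A : Type*} [Finite A] [Nonempty A] (C : Clone A) (n : ℕ) :
    (Pol {C.toRelation n}).ops n ⊆ C.ops n := fun _ hf =>
  (C.mem_pol_toRelation.1 hf).2 _ fun j => C.proj_mem n j

theorem antitone_pol_toRelation {A : Type*} [Finite A] [Nonempty A] (C : Clone A) :
    Antitone fun n => Pol {C.toRelation n} := by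
  refine antitone_nat_of_succ_le fun n => ?_
  rw [le_iff]
  intro m f hf
  rw [mem_pol_toRelation] at hf ⊢
  refine ⟨hf.1, fun g hg => ?_⟩
  have hn : 0 < n := C.arity_pos (hg ⟨0, hf.1⟩)
  have := C.comp_vars_mem (n := n)
    (hf.2 (fun j x => g j fun i => x i.castSucc) fun j => C.comp_vars_mem (hg j) Fin.castSucc)
    (Fin.snoc (fun i => i) ⟨0, hn⟩)
  simpa using this

theorem exists_eq_pol_singleton {A : Type*} [Finite A] {m : ℕ} {C : Clone A}
    (hC : C ∈ edgeClones A (m + 2)) : ∃ R : FinitaryRelation A, C = Pol {R} := by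
  rcases isEmpty_or_nonempty A with hA | hA
  · -- On the empty set, all operations of positive arity are projections.
    refine ⟨⟨1, one_pos, Set.univ⟩, Clone.ext (funext fun n => Set.ext fun f => ?_)⟩
    have key : ∀ D : Clone A, f ∈ D.ops n ↔ 0 < n := fun D =>
      ⟨D.arity_pos, fun hn => by
        rw [show f = fun x => x ⟨0, hn⟩ from funext fun x => isEmptyElim (x ⟨0, hn⟩)]
        exact D.proj_mem n ⟨0, hn⟩⟩
    rw [key, key]
  · have hmem : ∀ n, Pol {C.toRelation n} ∈ edgeClones A (m + 2) := fun n =>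
      hC.imp fun t ht => ⟨C.le_pol_toRelation n _ ht.1, ht.2⟩
    have hwf : WellFoundedLT (edgeClones A (m + 2)) := by
      rw [WellFoundedLT, isWellFounded_iff, RelEmbedding.wellFounded_iff_isEmpty]
      refine ⟨fun e => not_exists_strictAnti_edgeClones m ⟨fun n => (e n : Clone A),
        fun n => (e n).2, fun n => ?_⟩⟩
      exact e.map_rel_iff.2 (Nat.lt_succ_self n)
    obtain ⟨N, hN⟩ := Antitone.exists_forall_eq
      (c := fun n => (⟨_, hmem n⟩ : edgeClones A (m + 2))) fun _ _ h =>
        C.antitone_pol_toRelation h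
    refine ⟨C.toRelation N, (C.le_pol_toRelation N).antisymm ?_⟩
    rw [le_iff]
    intro n f hf
    refine C.pol_toRelation_ops_subset n ?_
    rcases le_total n N with h | h
    · exact C.antitone_pol_toRelation h n hf
    · have : Pol {C.toRelation n} = Pol {C.toRelation N} := congrArg Subtype.val (hN n h)
      rwa [this]

end Clone

instance FinitaryRelation.countable {A : Type*} [Finite A] : Countable (FinitaryRelation A) := by
  refine Function.Injective.countable (β := Σ n : ℕ, Set (Fin n → A))
    (f := fun R => ⟨R.arity, R.tuples⟩) ?_
  rintro ⟨n, _, R⟩ ⟨n', _, R'⟩ h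
  cases h
  rfl

theorem countable_edgeClones {A : Type*} [Finite A] (m : ℕ) : (edgeClones A (m + 2)).Countable :=
  (Set.countable_range fun R : FinitaryRelation A => Clone.Pol {R}).mono fun _ hC =>
    (Clone.exists_eq_pol_singleton hC).imp fun _ h => h.symm

/-- Exchanging the first two arguments turns a Malcev operation into a `2`-edge operation. -/
theorem malcevClones_subset_edgeClones (A : Type*) : malcevClones A ⊆ edgeClones A 2 := by
  rintro C ⟨m, hmC, hm⟩
  refine ⟨_, C.comp_vars_mem hmC ![1, 0, 2], fun x y => ?_, fun x y => ?_, fun i hi => by omega⟩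
  · refine Eq.trans (congrArg m ?_) (hm x y).2
    funext i
    fin_cases i <;> rfl
  · refine Eq.trans (congrArg m ?_) (hm x y).1
    funext i
    fin_cases i <;> rfl

theorem theorem6p2 {A : Type*} [Finite A] (k : ℕ) (hk : 1 < k) :
    (∀ C ∈ edgeClones A k, ∃ R : FinitaryRelation A, C = Clone.Pol {R}) ∧
    (¬ ∃ c : ℕ → Clone A, (∀ n, c n ∈ edgeClones A k) ∧ ∀ n, c (n + 1) < c n) ∧
    (edgeClones A k).Countable ∧
    (∀ C ∈ malcevClones A, C.FinitelyRelated) ∧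
    (malcevClones A).Countable := by
  obtain ⟨m, rfl⟩ := Nat.exists_eq_add_of_le' hk
  refine ⟨fun C => Clone.exists_eq_pol_singleton, Clone.not_exists_strictAnti_edgeClones m,
    countable_edgeClones m, fun C hC => ?_,
    (countable_edgeClones 0).mono (malcevClones_subset_edgeClones A)⟩
  obtain ⟨R, hR⟩ := Clone.exists_eq_pol_singleton (m := 0) (malcevClones_subset_edgeClones A hC)
  exact ⟨{R}, Set.finite_singleton R, hR⟩
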